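/- **Setting.** Let $X=\{0,1\}^*$ be the set of finite binary sequences, $|s|$ the length of $s\in X$, and $X^\infty$ the set of infinite binary sequences; for $\alpha\in X^\infty$ let $\alpha_n\in X$ be the prefix of $\alpha$ of length $n$. A *computer* is a partial recursive function $C\colon X\to X$ whose domain is prefix-free (no element of the domain is a prefix of another one), and $H_C(s)=\min\{|p| : C(p)=s\}\in\mathbb N\cup\{\infty\}$. A computer $U$ is *universal* if for every computer $C$ there is a constant $\mathrm{sim}(C)\in\mathbb N$ such that for every $p\in\operatorname{Dom}C$ there is a $q$ with $U(q)=C(p)$ and $|q|\le|p|+\mathrm{sim}(C)$. Let $U$ be any universal computer and put $H=H_U$. A real number $D$ is *computable* if the digits of a base-two expansion of $D-\lfloor D\rfloor$ are given by a total recursive function. Let $D\ge 0$ be real and $\alpha\in X^\infty$. - $\alpha$ is *weakly Chaitin $D$-random* if there is $c\in\mathbb R$ such that $Dn-c\le H(\alpha_n)$ for all $n\in\mathbb N$. - A *Martin-Löf $D$-test* is a recursively enumerable set $\mathcal T\subset\mathbb N\times X$ such that, with $\mathcal T_i=\{s : (i,s)\in\mathcal T\}$, $$\sum_{s\in\mathcal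 T_i}2^{-D|s|}\le 2^{-i}\qquad\text{for all } i\in\mathbb N.$$ - $\alpha$ is *Martin-Löf $D$-random* if for every Martin-Löf $D$-test $\mathcal T$ there is $i\in\mathbb N$ such that no prefix of $\alpha$ belongs to $\mathcal T_i$. **Theorem.** Let $D\ge 0$ be a computable real number. Then for every $\alpha\in X^\infty$, $\alpha$ is weakly Chaitin $D$-random if and only if $\alpha$ is Martin-Löf $D$-random. -/

import Mathlib

open scoped ENNReal

namespace DRandomness

/-- The real number `D` is computable: some total recursive function generates the digits
of a base-two expansion `0.f(0) f(1) f(2) …` of the fractional part of `D`. -/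
def IsComputableReal (D : ℝ) : Prop :=
  ∃ f : ℕ → Bool, Computable f ∧
    HasSum (fun n : ℕ => (if f n then 1 else 0 : ℝ) / 2 ^ (n + 1)) (Int.fract D)

/-- No sequence in `S` is a prefix of another sequence in `S`. -/
def IsPrefixFree (S : Set (List Bool)) : Prop :=
  ∀ p ∈ S, ∀ q ∈ S, p <+: q → p = q

/-- A computer: a partial recursive function on finite binary sequences with
prefix-free domain. -/
structure IsComputer (C : List Bool →. List Bool) : Prop where
  partrec : Partrec C
  prefixFree : IsPrefixFree C.Dom

/-- A universal computer: it simulates every computer with programs that are longer by at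
most a constant depending on the simulated computer. -/
structure IsUniversalComputer (U : List Bool →. List Bool) : Prop where
  isComputer : IsComputer U
  simulates : ∀ C : List Bool →. List Bool, IsComputer C →
    ∃ sim : ℕ, ∀ p s : List Bool, s ∈ C p →
      ∃ q : List Bool, s ∈ U q ∧ q.length ≤ p.length + sim

/-- The program-size complexity `H_C(s)`: the least length of a program `p` with `C p = s`,
and `∞` if there is none. -/
noncomputable def programSize (C : List Bool →. List Bool) (s : List Bool) : ℕ∞ :=
  ⨅ (p : List Bool) (_ : s ∈ C p), (p.length : ℕ∞)

/-- The prefix of length `n` of an infinite binary sequence. -/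
def initialSegment (α : ℕ → Bool) (n : ℕ) : List Bool :=
  (List.range n).map α

/-- The infinite binary sequences that begin with a finite sequence belonging to `S`. -/
def cylinder (S : Set (List Bool)) : Set (ℕ → Bool) :=
  {α | ∃ n : ℕ, initialSegment α n ∈ S}

/-- `α` is weakly Chaitin `D`-random (with respect to the universal computer `U`). -/
def IsWeaklyChaitinRandom (U : List Bool →. List Bool) (D : ℝ) (α : ℕ → Bool) : Prop :=
  ∃ c : ℝ, ∀ n : ℕ,
    ((D * n - c : ℝ) : EReal) ≤ ((programSize U (initialSegment α n) : ℝ≥0∞) : EReal)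

/-- The level `T_i` of a subset `T` of `ℕ × {0,1}*`. -/
def level (T : Set (ℕ × List Bool)) (i : ℕ) : Set (List Bool) :=
  {s | (i, s) ∈ T}

/-- A Martin-Löf `D`-test: a recursively enumerable set whose level `T_i` satisfies
`∑_{s ∈ T_i} 2^{-D|s|} ≤ 2^{-i}`, the sum being taken in `[0, ∞]`. -/
structure IsMartinLofTest (D : ℝ) (T : Set (ℕ × List Bool)) : Prop where
  re : REPred (fun x : ℕ × List Bool => x ∈ T)
  sum_le : ∀ i : ℕ,
    ∑' s : level T i, (2 : ℝ≥0∞) ^ (-(D * (s : List Bool).length)) ≤ 2 ^ (-(i : ℝ))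

/-- `α` is Martin-Löf `D`-random. -/
def IsMartinLofRandom (D : ℝ) (α : ℕ → Bool) : Prop :=
  ∀ T : Set (ℕ × List Bool), IsMartinLofTest D T → ∃ i : ℕ, α ∉ cylinder (level T i)

end DRandomness

/-! Kraft's inequality and its effective converse turn short programs into small sums and back.

Let level i of `compressionTest` consist of the s with a program shorter than D|s| - i. Distinct s
have distinct programs, so Kraft's inequality (`IsPrefixFree.tsum_le_one`) bounds the sum of
2^(-D|s|) by 2^(-i). This is a test, and a sequence avoiding level i satisfies Dn - i ≤ H(α_n).

Conversely, given a test T, request for each s in level 2i+1 a program of length about D|s| - i. The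
weights total at most ∑ 2^i 2^(-(2i+1)) = 1, so the Kraft–Chaitin theorem
(`exists_computer_of_requests`) yields a computer granting the requests up to O(1) bits
(`IsMartinLofTest.exists_computer`). Universality transfers this to U, and a prefix of α in level
2i+1 for large i contradicts Dn - c ≤ H(α_n).

Computability of D enters through dyadic approximations: they make the first test recursively
enumerable and the requested lengths computable. -/

namespace DRandomness

/-! ### Recursively enumerable predicates and stages of computations. -/

section Recursion

variable {α β σ : Type*} [Primcodable α] [Primcodable β] [Primcodable σ]

/-- A partial recursive function is the increasing union of its computations by stages. -/
theorem exists_stages {f : α →. σ} (hf : Partrec f) :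
    ∃ g : α → ℕ → Option σ, Computable₂ g ∧ (∀ x, g x 0 = none) ∧
      (∀ x m n s, m ≤ n → g x m = some s → g x n = some s) ∧
      ∀ x s, s ∈ f x ↔ ∃ k, g x k = some s := by
  obtain ⟨c, hc⟩ := Nat.Partrec.Code.exists_code.1 hf
  have key : ∀ x, c.eval (Encodable.encode x) = (f x).map Encodable.encode := by
    intro x
    rw [hc]
    simp
  refine ⟨fun x k => (c.evaln k (Encodable.encode x)).bind Encodable.decode, ?_, ?_, ?_, ?_⟩
  · have h : Computable fun p : α × ℕ => c.evaln p.2 (Encodable.encode p.1) :=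
      Nat.Partrec.Code.primrec_evaln.to_comp.comp
        ((Computable.snd.pair (Computable.const c)).pair
          (Computable.encode.comp Computable.fst))
    exact h.option_bind (Computable.decode.comp Computable.snd).to₂
  · intro x
    simp [Nat.Partrec.Code.evaln]
  · intro x m n s hmn h
    obtain ⟨y, hy, hs⟩ := Option.bind_eq_some_iff.1 h
    exact Option.bind_eq_some_iff.2 ⟨y, Nat.Partrec.Code.evaln_mono hmn hy, hs⟩
  · intro x s
    constructor
    · intro hs
      have : Encodable.encode s ∈ c.eval (Encodable.encode x) := by
        rw [key]
        exact Part.mem_map _ hs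
      obtain ⟨k, hk⟩ := Nat.Partrec.Code.evaln_complete.1 this
      exact ⟨k, Option.bind_eq_some_iff.2 ⟨_, hk, Encodable.encodek s⟩⟩
    · rintro ⟨k, hk⟩
      obtain ⟨y, hy, hs⟩ := Option.bind_eq_some_iff.1 hk
      have := Nat.Partrec.Code.evaln_sound hy
      rw [key] at this
      obtain ⟨t, ht, rfl⟩ := (Part.mem_map_iff _).1 this
      rw [Encodable.encodek, Option.some_inj] at hs
      exact hs ▸ ht

/-- A recursively enumerable predicate has a computable enumeration in which each of its
elements appears at exactly one stage. -/
theorem exists_enumeration {p : α → Prop} (hp : REPred p) :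
    ∃ h : α → ℕ → Bool, Computable₂ h ∧ (∀ x, p x ↔ ∃ k, h x k = true) ∧
      ∀ x k k', h x k = true → h x k' = true → k = k' := by
  obtain ⟨g, hg, h0, hmono, hmem⟩ := exists_stages hp
  have hp' : ∀ x, p x ↔ ∃ k, (g x k).isSome = true := by
    intro x
    have := hmem x ()
    simp only [Part.mem_assert_iff, Part.mem_some_iff, exists_prop, and_true] at this
    rw [show p x ↔ _ from by simpa using this]
    refine exists_congr fun k => ?_
    cases g x k <;> simp
  have hmono' : ∀ x m n, m ≤ n → (g x m).isSome = true → (g x n).isSome = true := by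
    intro x m n hmn h
    obtain ⟨s, hs⟩ := Option.isSome_iff_exists.1 h
    simp [hmono x m n s hmn hs]
  have hb : Primrec₂ fun a b : Bool => a && !b :=
    Primrec.and.comp Primrec.fst (Primrec.not.comp Primrec.snd)
  -- Stage k reports x only when the computation first halts at k + 1; monotonicity of the stages
  -- makes this k unique.
  refine ⟨fun x k => (g x (k + 1)).isSome && !(g x k).isSome, ?_, ?_, ?_⟩
  · have h1 : Computable fun q : α × ℕ => (g q.1 (q.2 + 1)).isSome :=
      Primrec.option_isSome.to_comp.comp
        (hg.comp Computable.fst (Computable.succ.comp Computable.snd))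
    have h2 : Computable fun q : α × ℕ => (g q.1 q.2).isSome :=
      Primrec.option_isSome.to_comp.comp (hg.comp Computable.fst Computable.snd)
    exact hb.to_comp.comp h1 h2
  · intro x
    rw [hp']
    constructor
    · rintro ⟨k, hk⟩
      induction k with
      | zero => simp [h0] at hk
      | succ k ih =>
        cases h : (g x k).isSome
        · exact ⟨k, by simp [hk, h]⟩
        · exact ih h
    · rintro ⟨k, hk⟩
      rw [Bool.and_eq_true] at hk
      exact ⟨k + 1, hk.1⟩
  · intro x k k' hk hk'
    simp only [Bool.and_eq_true, Bool.not_eq_true'] at hk hk'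
    by_contra hne
    rcases Nat.lt_or_gt_of_ne hne with h | h
    · have := hmono' x (k + 1) k' h hk.1
      simp [hk'.2] at this
    · have := hmono' x (k' + 1) k h hk'.1
      simp [hk.2] at this

/-- The projection of a computable relation is recursively enumerable. -/
theorem rePred_exists {h : α → β → Bool} (hh : Computable₂ h) :
    REPred fun x => ∃ b, h x b = true := by
  have hdec : Computable fun q : α × ℕ => (Encodable.decode q.2 : Option β) :=
    Computable.decode.comp Computable.snd
  have hstage : Computable₂ fun (x : α) (n : ℕ) =>
      (Encodable.decode n : Option β).bind fun b => cond (h x b) (some ()) none := by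
    refine hdec.option_bind (show Computable _ from ?_)
    exact Computable.cond (hh.comp (Computable.fst.comp Computable.fst) Computable.snd)
      (Computable.const _) (Computable.const _)
  refine (Partrec.dom_re (Partrec.rfindOpt hstage)).of_eq fun x => ?_
  rw [Nat.rfindOpt_dom]
  constructor
  · rintro ⟨n, u, hu⟩
    obtain ⟨b, -, hb⟩ := Option.bind_eq_some_iff.1 hu
    refine ⟨b, ?_⟩
    cases hx : h x b <;> simp_all
  · rintro ⟨b, hb⟩
    exact ⟨Encodable.encode b, (), by simp [hb]⟩

end Recursion

/-! ### Dyadic approximation of computable reals. -/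

theorem primrec_two_pow : Primrec fun n : ℕ => 2 ^ n :=
  (Primrec₂.unpaired'.1 Nat.Primrec.pow).comp (Primrec.const 2) Primrec.id

theorem primrec_toNat : Primrec Bool.toNat :=
  (Primrec.cond Primrec.id (Primrec.const 1) (Primrec.const 0)).of_eq fun b => by cases b <;> rfl

/-- The natural number obtained by appending the binary digits `f 0, …, f (k - 1)` to `a`. -/
def binaryDigitsValue (a : ℕ) (f : ℕ → Bool) (k : ℕ) : ℕ :=
  Nat.rec a (fun n b => 2 * b + (f n).toNat) k

/-- The dyadic lower approximations `A k / 2 ^ k` of a computable real number. -/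
theorem IsComputableReal.exists_approx {D : ℝ} (hD : IsComputableReal D) (hD0 : 0 ≤ D) :
    ∃ A : ℕ → ℕ, Computable A ∧ ∀ k, (A k : ℝ) ≤ D * 2 ^ k ∧ D * 2 ^ k ≤ A k + 1 := by
  obtain ⟨f, hf, hsum⟩ := hD
  set d : ℕ → ℝ := fun n => (if f n then 1 else 0 : ℝ) / 2 ^ (n + 1) with hd
  have hd0 : ∀ n, 0 ≤ d n := fun n => by simp only [hd]; positivity
  have hd1 : ∀ n, d n ≤ 1 / 2 ^ (n + 1) := fun n => by
    simp only [hd]; gcongr; split_ifs <;> norm_num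
  set A := binaryDigitsValue ⌊D⌋₊ f with hAdef
  have hA : ∀ k : ℕ, (A k : ℝ) = 2 ^ k * (⌊D⌋₊ + ∑ n ∈ Finset.range k, d n) := by
    intro k
    induction k with
    | zero => simp [hAdef, binaryDigitsValue]
    | succ k ih =>
      have : A (k + 1) = 2 * A k + (f k).toNat := rfl
      rw [this, Finset.sum_range_succ]
      push_cast
      rw [ih]
      simp only [hd]
      cases f k <;> simp <;> field_simp <;> ring
  have hDfloor : D = ⌊D⌋₊ + Int.fract D := by
    rw [natCast_floor_eq_intCast_floor hD0, Int.floor_add_fract]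
  refine ⟨A, ?_, fun k => ?_⟩
  · refine Computable.nat_rec Computable.id (Computable.const ⌊D⌋₊)
      (h := fun _ b => 2 * b.2 + (f b.1).toNat) (show Computable _ from ?_)
    have h1 : Computable fun q : ℕ × ℕ × ℕ => 2 * q.2.2 :=
      Primrec.nat_double.to_comp.comp (Computable.snd.comp Computable.snd)
    have h2 : Computable fun q : ℕ × ℕ × ℕ => (f q.2.1).toNat :=
      primrec_toNat.to_comp.comp (hf.comp (Computable.fst.comp Computable.snd))
    exact Primrec.nat_add.to_comp.comp h1 h2
  · have hlow : ∑ n ∈ Finset.range k, d n ≤ Int.fract D :=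
      sum_le_hasSum _ (fun n _ => hd0 n) hsum
    -- The remaining digits contribute at most a full geometric tail. All of them may be 1, so the
    -- bound is not strict.
    have hup : Int.fract D ≤ ∑ n ∈ Finset.range k, d n + 1 / 2 ^ k := by
      have h1 := (hasSum_nat_add_iff' k).2 hsum
      have h2 : HasSum (fun n : ℕ => (1 : ℝ) / 2 ^ (n + k + 1)) (1 / 2 ^ k) := by
        have := (hasSum_geometric_two' ((1 : ℝ) / 2 ^ k))
        refine this.congr_fun fun n => ?_
        field_simp
        ring
      have := hasSum_le (fun n => hd1 (n + k)) h1 h2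
      linarith
    rw [hA]
    constructor
    · calc (2 : ℝ) ^ k * (⌊D⌋₊ + ∑ n ∈ Finset.range k, d n)
          ≤ 2 ^ k * (⌊D⌋₊ + Int.fract D) := by gcongr
        _ = D * 2 ^ k := by rw [← hDfloor, mul_comm]
    · have : D * 2 ^ k = 2 ^ k * (⌊D⌋₊ + Int.fract D) := by rw [← hDfloor]; ring
      rw [this]
      calc (2 : ℝ) ^ k * (⌊D⌋₊ + Int.fract D)
          ≤ 2 ^ k * (⌊D⌋₊ + (∑ n ∈ Finset.range k, d n + 1 / 2 ^ k)) := by gcongr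
        _ = _ := by field_simp; ring

/-! ### Codewords as dyadic intervals, and the Kraft–Chaitin theorem. -/

section Coding

/-- The natural number with binary expansion `p`, most significant digit first. -/
def binaryValue (p : List Bool) : ℕ :=
  p.foldl (fun a b => 2 * a + b.toNat) 0

theorem binaryValue_concat (p : List Bool) (b : Bool) :
    binaryValue (p ++ [b]) = 2 * binaryValue p + b.toNat := by
  simp [binaryValue]

theorem binaryValue_lt (p : List Bool) : binaryValue p < 2 ^ p.length := by
  induction p using List.reverseRecOn with
  | nil => simp [binaryValue]
  | append_singleton p b ih =>
    rw [binaryValue_concat, List.length_append, List.length_singleton, pow_succ]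
    have := b.toNat_le
    omega

theorem binaryValue_append (p r : List Bool) :
    binaryValue (p ++ r) = binaryValue p * 2 ^ r.length + binaryValue r := by
  induction r using List.reverseRecOn with
  | nil => simp [binaryValue]
  | append_singleton r b ih =>
    rw [← List.append_assoc, binaryValue_concat, binaryValue_concat, ih, List.length_append,
      List.length_singleton, pow_succ]
    ring

theorem exists_binaryValue_eq (L m : ℕ) (hm : m < 2 ^ L) :
    ∃ p : List Bool, p.length = L ∧ binaryValue p = m := by
  induction L generalizing m with
  | zero => exact ⟨[], rfl, by simp only [pow_zero] at hm; simp [binaryValue]; omega⟩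
  | succ L ih =>
    rw [pow_succ] at hm
    obtain ⟨p, hp, hv⟩ := ih (m / 2) (by omega)
    refine ⟨p ++ [m % 2 == 1], by simp [hp], ?_⟩
    rw [binaryValue_concat, hv]
    rcases Nat.mod_two_eq_zero_or_one m with h | h <;> simp [h] <;> omega

theorem eq_of_length_of_binaryValue {p q : List Bool} (hl : p.length = q.length)
    (hv : binaryValue p = binaryValue q) : p = q := by
  induction p using List.reverseRecOn generalizing q with
  | nil => exact (List.length_eq_zero_iff.1 hl.symm).symm
  | append_singleton p b ih =>
    rcases List.eq_nil_or_concat q with rfl | ⟨q, c, rfl⟩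
    · simp at hl
    · rw [List.concat_eq_append] at *
      rw [binaryValue_concat, binaryValue_concat] at hv
      have hb := b.toNat_le
      have hc := c.toNat_le
      have hbc : b = c := by
        cases b <;> cases c <;> simp at hv ⊢ <;> omega
      rw [ih (q := q) (by simpa using hl) (by omega), hbc]

theorem primrec_binaryValue : Primrec binaryValue := by
  refine Primrec.list_foldl Primrec.id (Primrec.const 0)
    (h := fun _ (b : ℕ × Bool) => 2 * b.1 + b.2.toNat) (show Primrec _ from ?_)
  exact Primrec.nat_add.comp
    (Primrec.nat_double.comp (Primrec.fst.comp Primrec.snd))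
    (primrec_toNat.comp (Primrec.snd.comp Primrec.snd))

/-- The weight `2 ^ (-l)` of a request for a program of length `l`. -/
noncomputable def requestWeight (r : Option (List Bool × ℕ)) : ℝ :=
  r.elim 0 fun x => (1 / 2) ^ x.2

theorem requestWeight_nonneg (r : Option (List Bool × ℕ)) : 0 ≤ requestWeight r := by
  cases r <;> simp [requestWeight]

/-- Add `2 ^ (-l)` to the fraction `a.1 / 2 ^ a.2`. -/
def addRequest (a : ℕ × ℕ) (l : ℕ) : ℕ × ℕ :=
  (a.1 * 2 ^ l + 2 ^ a.2, a.2 + l)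

theorem primrec_addRequest : Primrec₂ addRequest :=
  (Primrec.nat_add.comp
    (Primrec.nat_mul.comp (Primrec.fst.comp Primrec.fst) (primrec_two_pow.comp Primrec.snd))
    (primrec_two_pow.comp (Primrec.snd.comp Primrec.fst))).pair
    (Primrec.nat_add.comp (Primrec.snd.comp Primrec.fst) Primrec.snd)

/-- The total weight of the first `j` requests, as a fraction `num / 2 ^ exp`. -/
def requestSum (req : ℕ → Option (List Bool × ℕ)) (j : ℕ) : ℕ × ℕ :=
  Nat.rec (0, 0) (fun k a => (req k).elim a fun x => addRequest a x.2) j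

theorem requestSum_eq (req : ℕ → Option (List Bool × ℕ)) (j : ℕ) :
    ((requestSum req j).1 : ℝ) / 2 ^ (requestSum req j).2 =
      ∑ k ∈ Finset.range j, requestWeight (req k) := by
  induction j with
  | zero => simp [requestSum]
  | succ j ih =>
    have h : requestSum req (j + 1) = (req j).elim (requestSum req j) fun x =>
      addRequest (requestSum req j) x.2 := rfl
    rw [Finset.sum_range_succ, ← ih, h]
    cases req j with
    | none => simp [requestWeight]
    | some x =>
      simp only [Option.elim_some, requestWeight, addRequest]
      push_cast
      rw [pow_add, one_div, inv_pow]
      field_simp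

theorem computable_requestSum {req : ℕ → Option (List Bool × ℕ)} (hreq : Computable req) :
    Computable (requestSum req) := by
  have hstep : Computable₂ fun (_ : ℕ) (b : ℕ × ℕ × ℕ) =>
      (req b.1).elim b.2 fun x => addRequest b.2 x.2 := by
    have h : Computable₂ fun (q : ℕ × ℕ × ℕ × ℕ) (x : List Bool × ℕ) => addRequest q.2.2 x.2 :=
      primrec_addRequest.to_comp.comp
        (Computable.snd.comp (Computable.snd.comp Computable.fst))
        (Computable.snd.comp Computable.snd)
    refine (Computable.option_casesOn (hreq.comp (Computable.fst.comp Computable.snd))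
      (Computable.snd.comp Computable.snd) h).of_eq ?_
    rintro ⟨n, k, a⟩
    dsimp only
    cases req k <;> rfl
  exact Computable.nat_rec Computable.id (Computable.const (0, 0)) hstep

/-- `p` is the codeword of length `l + 1` that is assigned to a request for a program of
length `l` when the earlier requests have total weight `a.1 / 2 ^ a.2`. -/
def IsCodeword (a : ℕ × ℕ) (l : ℕ) (p : List Bool) : Prop :=
  p.length = l + 1 ∧ binaryValue p = a.1 * 2 ^ (l + 1) / 2 ^ a.2 + 1

instance (a : ℕ × ℕ) (l : ℕ) (p : List Bool) : Decidable (IsCodeword a l p) :=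
  inferInstanceAs (Decidable (_ ∧ _))

/-- The output of `p` when it is the codeword assigned to the request `x`. -/
def codewordOutput (a : ℕ × ℕ) (q : List Bool × List Bool × ℕ) : Option (List Bool) :=
  if IsCodeword a q.2.2 q.1 then some q.2.1 else none

theorem primrec_codewordOutput : Primrec₂ codewordOutput := by
  have hl : Primrec fun q : (ℕ × ℕ) × List Bool × List Bool × ℕ => q.2.2.2 + 1 :=
    Primrec.succ.comp (Primrec.snd.comp (Primrec.snd.comp Primrec.snd))
  have hp : Primrec fun q : (ℕ × ℕ) × List Bool × List Bool × ℕ => q.2.1 :=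
    Primrec.fst.comp Primrec.snd
  have hm : Primrec fun q : (ℕ × ℕ) × List Bool × List Bool × ℕ =>
      q.1.1 * 2 ^ (q.2.2.2 + 1) / 2 ^ q.1.2 + 1 :=
    Primrec.succ.comp (Primrec.nat_div.comp
      (Primrec.nat_mul.comp (Primrec.fst.comp Primrec.fst) (primrec_two_pow.comp hl))
      (primrec_two_pow.comp (Primrec.snd.comp Primrec.fst)))
  exact Primrec.ite ((Primrec.eq.comp (Primrec.list_length.comp hp) hl).and
      (Primrec.eq.comp (primrec_binaryValue.comp hp) hm))
    (Primrec.option_some.comp (Primrec.fst.comp (Primrec.snd.comp Primrec.snd)))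
    (Primrec.const none)

/-- A codeword denotes a dyadic interval inside the interval allotted to its request. -/
theorem IsCodeword.bounds {a : ℕ × ℕ} {l : ℕ} {p : List Bool} (h : IsCodeword a l p) :
    (a.1 : ℝ) / 2 ^ a.2 < binaryValue p / 2 ^ p.length ∧
      (binaryValue p + 1 : ℝ) / 2 ^ p.length ≤ a.1 / 2 ^ a.2 + (1 / 2) ^ l := by
  obtain ⟨h1, h2⟩ := h
  -- An interval of length 2^(-l) need not be dyadic, but it contains a dyadic one of half the
  -- length; hence the extra bit. Taking m + 1 rather than m puts the left endpoint strictly inside.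
  set m := a.1 * 2 ^ (l + 1) / 2 ^ a.2 with hm
  have hlow : m * 2 ^ a.2 ≤ a.1 * 2 ^ (l + 1) := Nat.div_mul_le_self _ _
  have hup : a.1 * 2 ^ (l + 1) < (m + 1) * 2 ^ a.2 := by
    rw [mul_comm (m + 1)]
    exact Nat.lt_mul_div_succ _ (by positivity)
  have hlow' : (m : ℝ) * 2 ^ a.2 ≤ a.1 * 2 ^ (l + 1) := by exact_mod_cast hlow
  have hup' : (a.1 : ℝ) * 2 ^ (l + 1) < (m + 1) * 2 ^ a.2 := by exact_mod_cast hup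
  rw [h1, h2]
  push_cast
  constructor
  · rwa [div_lt_div_iff₀ (by positivity) (by positivity)]
  · have h3 : (m : ℝ) / 2 ^ (l + 1) ≤ a.1 / 2 ^ a.2 := by
      rwa [div_le_div_iff₀ (by positivity) (by positivity)]
    have h4 : (1 / 2 : ℝ) ^ l = 2 / 2 ^ (l + 1) := by
      rw [pow_succ, one_div, inv_pow]
      field_simp
    rw [h4, show (m + 1 + 1 : ℝ) = m + 2 by ring, add_div]
    gcongr

/-- The only obstruction is overflow: the value m + 1 must fit in l + 1 digits, which holds because
the allotted interval ends at or before 1. -/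
theorem exists_isCodeword {a : ℕ × ℕ} {l : ℕ} (h : (a.1 : ℝ) / 2 ^ a.2 + (1 / 2) ^ l ≤ 1) :
    ∃ p, IsCodeword a l p := by
  suffices a.1 * 2 ^ (l + 1) / 2 ^ a.2 + 1 < 2 ^ (l + 1) by
    obtain ⟨p, hp, hv⟩ := exists_binaryValue_eq _ _ this
    exact ⟨p, hp, hv⟩
  have h1 : a.1 * 2 ^ (l + 1) / 2 ^ a.2 + 2 ≤ 2 ^ (l + 1) := by
    have h2 : ((a.1 * 2 ^ (l + 1) / 2 ^ a.2 : ℕ) : ℝ) ≤ a.1 / 2 ^ a.2 * 2 ^ (l + 1) := by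
      refine Nat.cast_div_le.trans (le_of_eq ?_)
      push_cast
      ring
    have h3 : ((1 : ℝ) / 2) ^ l * 2 ^ (l + 1) = 2 := by
      rw [pow_succ, ← mul_assoc, ← mul_pow]
      norm_num
    have h4 := mul_le_mul_of_nonneg_right h (by positivity : (0 : ℝ) ≤ 2 ^ (l + 1))
    rw [add_mul, h3, one_mul] at h4
    have : ((a.1 * 2 ^ (l + 1) / 2 ^ a.2 : ℕ) : ℝ) + 2 ≤ 2 ^ (l + 1) := by linarith
    exact_mod_cast this
  omega

/-- If `p` is a prefix of `q`, then the dyadic interval of `q` lies in that of `p`. -/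
theorem interval_subset_of_prefix {p q : List Bool} (h : p <+: q) :
    (binaryValue p : ℝ) / 2 ^ p.length ≤ binaryValue q / 2 ^ q.length ∧
      (binaryValue q + 1 : ℝ) / 2 ^ q.length ≤ (binaryValue p + 1) / 2 ^ p.length := by
  obtain ⟨r, rfl⟩ := h
  have hr : (binaryValue r : ℝ) + 1 ≤ 2 ^ r.length := by exact_mod_cast binaryValue_lt r
  rw [binaryValue_append, List.length_append, pow_add]
  push_cast
  constructor
  · rw [div_le_div_iff₀ (by positivity) (by positivity)]
    have : (0 : ℝ) ≤ binaryValue r * 2 ^ p.length := by positivity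
    nlinarith
  · rw [div_le_div_iff₀ (by positivity) (by positivity)]
    have : (0 : ℝ) < 2 ^ p.length := by positivity
    nlinarith

/-- **Kraft–Chaitin theorem**: computably many requests `(s, l)` of total weight at most one
are satisfied by a computer, up to one additional bit. -/
theorem exists_computer_of_requests {req : ℕ → Option (List Bool × ℕ)} (hreq : Computable req)
    (hsum : ∀ n, ∑ j ∈ Finset.range n, requestWeight (req j) ≤ 1) :
    ∃ C, IsComputer C ∧ ∀ j s l, req j = some (s, l) → ∃ p, s ∈ C p ∧ p.length = l + 1 := by
  let out : List Bool → ℕ → Option (List Bool) := fun p j =>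
    (req j).bind fun x => codewordOutput (requestSum req j) (p, x)
  have hout_iff : ∀ p j s, out p j = some s ↔
      ∃ l, req j = some (s, l) ∧ IsCodeword (requestSum req j) l p := by
    intro p j s
    simp only [out, codewordOutput, Option.bind_eq_some_iff, Prod.exists]
    constructor
    · rintro ⟨s', l, h, h'⟩
      split_ifs at h' with hc
      cases h'
      exact ⟨l, h, hc⟩
    · rintro ⟨l, h, hc⟩
      exact ⟨s, l, h, if_pos hc⟩
  have hout : Computable₂ out := by
    have h : Computable₂ fun (q : List Bool × ℕ) (x : List Bool × ℕ) =>
        codewordOutput (requestSum req q.2) (q.1, x) :=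
      primrec_codewordOutput.to_comp.comp
        ((computable_requestSum hreq).comp (Computable.snd.comp Computable.fst))
        ((Computable.fst.comp Computable.fst).pair Computable.snd)
    exact (hreq.comp Computable.snd).option_bind h
  have hx : ∀ j k s l, req j = some (s, l) → j < k →
      ((requestSum req j).1 : ℝ) / 2 ^ (requestSum req j).2 + (1 / 2) ^ l ≤
        (requestSum req k).1 / 2 ^ (requestSum req k).2 := by
    intro j k s l hj hjk
    have hw : ((1 : ℝ) / 2) ^ l = requestWeight (req j) := by rw [hj]; rfl
    rw [requestSum_eq, requestSum_eq, hw, ← Finset.sum_range_succ]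
    exact Finset.sum_le_sum_of_subset_of_nonneg (Finset.range_mono hjk)
      fun _ _ _ => requestWeight_nonneg _
  -- Comparable codewords have nested intervals, while different requests own intervals with
  -- disjoint interiors. With p = q this also shows that the output does not depend on the stage
  -- found by the search.
  have hindex : ∀ p q j k s t, out p j = some s → out q k = some t → p <+: q → j = k := by
    intro p q j k s t hp hq hpq
    obtain ⟨l, hj, hcp⟩ := (hout_iff _ _ _).1 hp
    obtain ⟨m, hk, hcq⟩ := (hout_iff _ _ _).1 hq
    have hpq' := interval_subset_of_prefix hpq
    have hlt : (binaryValue q : ℝ) / 2 ^ q.length < (binaryValue q + 1) / 2 ^ q.length := by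
      gcongr
      linarith
    have h1 := hcp.bounds
    have h2 := hcq.bounds
    rcases lt_trichotomy j k with h | h | h
    · have := hx j k s l hj h
      linarith
    · exact h
    · have := hx k j t m hk h
      linarith
  have hdom : ∀ p, (Nat.rfindOpt (out p)).Dom → ∃ j s, out p j = some s := fun p h =>
    Nat.rfindOpt_dom.1 h
  refine ⟨fun p => Nat.rfindOpt (out p), ⟨Partrec.rfindOpt hout, ?_⟩, ?_⟩
  · intro p hp q hq hpq
    obtain ⟨j, s, hj⟩ := hdom p hp
    obtain ⟨k, t, hk⟩ := hdom q hq
    obtain rfl := hindex p q j k s t hj hk hpq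
    obtain ⟨l, hl, hcp⟩ := (hout_iff _ _ _).1 hj
    obtain ⟨m, hm, hcq⟩ := (hout_iff _ _ _).1 hk
    rw [hl] at hm
    obtain ⟨rfl, rfl⟩ := Prod.mk.inj (Option.some_inj.1 hm)
    exact eq_of_length_of_binaryValue (hcp.1.trans hcq.1.symm) (hcp.2.trans hcq.2.symm)
  · intro j s l hj
    obtain ⟨p, hp⟩ := exists_isCodeword (a := requestSum req j) (l := l) (by
      have hw : ((1 : ℝ) / 2) ^ l = requestWeight (req j) := by rw [hj]; rfl
      rw [requestSum_eq, hw, ← Finset.sum_range_succ]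
      exact hsum _)
    have hpj : out p j = some s := (hout_iff _ _ _).2 ⟨l, hj, hp⟩
    refine ⟨p, ?_, hp.1⟩
    have hd : (Nat.rfindOpt (out p)).Dom := Nat.rfindOpt_dom.2 ⟨j, s, hpj⟩
    obtain ⟨k, hk⟩ := Nat.rfindOpt_spec (Part.get_mem hd)
    have := hindex p p j k _ _ hpj hk List.prefix_rfl
    subst this
    rw [Option.mem_def, hpj, Option.some_inj] at hk
    exact hk ▸ Part.get_mem hd

end Coding

/-! ### Kraft's inequality for prefix-free sets. -/

theorem ofReal_half_pow (n : ℕ) :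
    ENNReal.ofReal ((1 / 2) ^ n) = (2 : ℝ≥0∞) ^ (-(n : ℝ)) := by
  have h : (2 : ℝ≥0∞) = ENNReal.ofReal 2 := by simp
  rw [h, ENNReal.ofReal_rpow_of_pos two_pos, Real.rpow_neg two_pos.le, Real.rpow_natCast,
    one_div, inv_pow]

theorem IsPrefixFree.mono {S T : Set (List Bool)} (hT : IsPrefixFree T) (h : S ⊆ T) :
    IsPrefixFree S :=
  fun p hp q hq => hT p (h hp) q (h hq)

/-- The first words of two factorizations of one string are both prefixes of it, hence comparable,
hence equal; cancel and induct. The empty word must be excluded, as it can be inserted anywhere. -/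
theorem IsPrefixFree.uniquelyDecodable {S : Set (List Bool)} (hS : IsPrefixFree S)
    (hnil : [] ∉ S) : InformationTheory.UniquelyDecodable S := by
  intro L₁
  induction L₁ with
  | nil =>
    intro L₂ _ h₂ h
    cases L₂ with
    | nil => rfl
    | cons q L₂ =>
      have hq : q = [] := by simp at h; tauto
      exact absurd (hq ▸ h₂ q (by simp)) hnil
  | cons p L₁ ih =>
    intro L₂ h₁ h₂ h
    cases L₂ with
    | nil =>
      have hp : p = [] := by simp at h; tauto
      exact absurd (hp ▸ h₁ p (by simp)) hnil
    | cons q L₂ =>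
      rw [List.flatten_cons, List.flatten_cons] at h
      have hpq : p = q := by
        rcases List.prefix_or_prefix_of_prefix (List.prefix_append p _)
          (h ▸ List.prefix_append q _) with h' | h'
        · exact hS p (h₁ p (by simp)) q (h₂ q (by simp)) h'
        · exact (hS q (h₂ q (by simp)) p (h₁ p (by simp)) h').symm
      subst hpq
      rw [ih L₂ (fun w hw => h₁ w (by simp [hw])) (fun w hw => h₂ w (by simp [hw]))
        (List.append_cancel_left h)]

theorem IsPrefixFree.sum_le_one {F : Finset (List Bool)}
    (hF : IsPrefixFree (F : Set (List Bool))) : ∑ p ∈ F, (1 / 2 : ℝ) ^ p.length ≤ 1 := by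
  by_cases hnil : [] ∈ F
  · have : F = {[]} := Finset.eq_singleton_iff_unique_mem.2
      ⟨hnil, fun q hq => (hF [] hnil q hq List.nil_prefix).symm⟩
    simp [this]
  · simpa using InformationTheory.kraft_mcmillan_inequality (hF.uniquelyDecodable (by simpa))

theorem IsPrefixFree.tsum_le_one {S : Set (List Bool)} (hS : IsPrefixFree S) :
    ∑' p : S, (2 : ℝ≥0∞) ^ (-((p : List Bool).length : ℝ)) ≤ 1 := by
  classical
  rw [ENNReal.tsum_eq_iSup_sum]
  refine iSup_le fun F => ?_
  have h := IsPrefixFree.sum_le_one (F := F.map (Function.Embedding.subtype _))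
    (hS.mono fun p hp => by
      simp only [Finset.coe_map, Set.mem_image] at hp
      obtain ⟨x, -, rfl⟩ := hp
      exact x.2)
  rw [Finset.sum_map] at h
  simp_rw [← ofReal_half_pow]
  rw [← ENNReal.ofReal_sum_of_nonneg fun _ _ => by positivity]
  simpa using ENNReal.ofReal_le_ofReal h

/-! ### Program-size complexity without extended reals. -/

theorem le_programSize_iff {C : List Bool →. List Bool} {s : List Bool} {x : ℝ} :
    (x : EReal) ≤ ((programSize C s : ℝ≥0∞) : EReal) ↔ ∀ p, s ∈ C p → x ≤ p.length := by
  constructor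
  · intro h p hp
    have h1 : programSize C s ≤ p.length := iInf₂_le p hp
    have h2 : ((programSize C s : ℝ≥0∞) : EReal) ≤ (((p.length : ℕ∞) : ℝ≥0∞) : EReal) := by
      exact_mod_cast h1
    have h3 := h.trans h2
    have h4 : (((p.length : ℕ∞) : ℝ≥0∞) : EReal) = ((p.length : ℝ) : EReal) := by simp; rfl
    rw [h4] at h3
    exact_mod_cast h3
  · intro h
    rcases eq_or_ne (programSize C s) ⊤ with htop | htop
    · simp [htop]
    · obtain ⟨n, hn⟩ := ENat.ne_top_iff_exists.1 htop
      -- A finite infimum of lengths is attained: a program shorter than n + 1 has length at most n.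
      have hlt : programSize C s < ((n + 1 : ℕ) : ℕ∞) := by
        rw [← hn]
        exact_mod_cast Nat.lt_succ_self n
      obtain ⟨p, hp⟩ := iInf_lt_iff.1 hlt
      obtain ⟨hsp, hp⟩ := iInf_lt_iff.1 hp
      have hpn : p.length ≤ n := Nat.lt_succ_iff.1 (by exact_mod_cast hp)
      have hxn : x ≤ n := (h p hsp).trans (by exact_mod_cast hpn)
      rw [← hn]
      have h4 : (((n : ℕ∞) : ℝ≥0∞) : EReal) = ((n : ℝ) : EReal) := by simp; rfl
      rw [h4]
      exact_mod_cast hxn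

theorem isWeaklyChaitinRandom_iff {U : List Bool →. List Bool} {D : ℝ} {α : ℕ → Bool} :
    IsWeaklyChaitinRandom U D α ↔
      ∃ c : ℝ, ∀ n p, initialSegment α n ∈ U p → D * n - c ≤ p.length := by
  simp_rw [IsWeaklyChaitinRandom, le_programSize_iff]

@[simp]
theorem length_initialSegment (α : ℕ → Bool) (n : ℕ) : (initialSegment α n).length = n := by
  simp [initialSegment]

/-! ### From Martin-Löf randomness to incompressibility. -/

/-- The set of pairs `(i, s)` such that `s` has a program shorter than `D * |s| - i`. -/
def compressionTest (C : List Bool →. List Bool) (D : ℝ) : Set (ℕ × List Bool) :=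
  {x | ∃ q, x.2 ∈ C q ∧ (q.length + x.1 : ℝ) < D * x.2.length}

/-- The inequality is strict, so it is certified by some lower approximation of D at a finite
precision k, just as membership in the range of C is certified at a finite stage. -/
theorem rePred_compressionTest {C : List Bool →. List Bool} (hC : Partrec C) {D : ℝ}
    (hD : IsComputableReal D) (hD0 : 0 ≤ D) :
    REPred fun x : ℕ × List Bool => x ∈ compressionTest C D := by
  obtain ⟨A, hA, hAD⟩ := hD.exists_approx hD0
  obtain ⟨g, hg, -, -, hmem⟩ := exists_stages hC
  let h : ℕ × List Bool → List Bool × ℕ × ℕ → Bool := fun x b =>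
    decide (g b.1 b.2.1 = some x.2) &&
      decide ((b.1.length + x.1) * 2 ^ b.2.2 < A b.2.2 * x.2.length)
  have hh : Computable₂ h := by
    have h1 : Computable fun z : (ℕ × List Bool) × List Bool × ℕ × ℕ =>
        decide (g z.2.1 z.2.2.1 = some z.1.2) :=
      (Primrec.eq (α := Option (List Bool))).decide.to_comp.comp
        (hg.comp (Computable.fst.comp Computable.snd)
          (Computable.fst.comp (Computable.snd.comp Computable.snd)))
        (Computable.option_some.comp (Computable.snd.comp Computable.fst))
    have hk : Primrec fun z : (ℕ × List Bool) × List Bool × ℕ × ℕ => z.2.2.2 :=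
      Primrec.snd.comp (Primrec.snd.comp Primrec.snd)
    have h2 : Primrec fun z : (ℕ × List Bool) × List Bool × ℕ × ℕ =>
        (z.2.1.length + z.1.1) * 2 ^ z.2.2.2 :=
      Primrec.nat_mul.comp
        (Primrec.nat_add.comp (Primrec.list_length.comp (Primrec.fst.comp Primrec.snd))
          (Primrec.fst.comp Primrec.fst))
        (primrec_two_pow.comp hk)
    have h3 : Computable fun z : (ℕ × List Bool) × List Bool × ℕ × ℕ =>
        A z.2.2.2 * z.1.2.length :=
      Primrec.nat_mul.to_comp.comp (hA.comp hk.to_comp)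
        (Primrec.list_length.comp (Primrec.snd.comp Primrec.fst)).to_comp
    exact Primrec.and.to_comp.comp h1 (Primrec.nat_lt.decide.to_comp.comp h2.to_comp h3)
  refine (rePred_exists hh).of_eq fun x => ?_
  simp only [h, Bool.and_eq_true, decide_eq_true_eq, compressionTest, Set.mem_ofPred_eq]
  constructor
  · rintro ⟨⟨q, t, k⟩, hq, hlt⟩
    refine ⟨q, (hmem _ _).2 ⟨t, hq⟩, ?_⟩
    have h1 : ((q.length + x.1 : ℝ)) * 2 ^ k < A k * x.2.length := by exact_mod_cast hlt
    have h2 : (A k : ℝ) * x.2.length ≤ D * 2 ^ k * x.2.length := by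
      gcongr
      exact (hAD k).1
    have h3 : (0 : ℝ) < 2 ^ k := by positivity
    refine lt_of_mul_lt_mul_right ?_ h3.le
    linarith
  · rintro ⟨q, hq, hlt⟩
    obtain ⟨t, ht⟩ := (hmem _ _).1 hq
    -- Replacing D by A k / 2^k costs at most |s| / 2^k, which this k makes smaller than the gap.
    obtain ⟨k, hk⟩ := pow_unbounded_of_one_lt
      ((x.2.length : ℝ) / (D * x.2.length - (q.length + x.1))) one_lt_two
    refine ⟨⟨q, t, k⟩, ht, ?_⟩
    rw [div_lt_iff₀ (by linarith)] at hk
    have h2 : D * 2 ^ k * x.2.length ≤ (A k + 1) * x.2.length := by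
      gcongr
      exact (hAD k).2
    have h1 : ((q.length + x.1 : ℝ)) * 2 ^ k < A k * x.2.length := by linarith
    exact_mod_cast h1

theorem isMartinLofTest_compressionTest {C : List Bool →. List Bool} (hC : IsComputer C) {D : ℝ}
    (hD : IsComputableReal D) (hD0 : 0 ≤ D) : IsMartinLofTest D (compressionTest C D) := by
  refine ⟨rePred_compressionTest hC.partrec hD hD0, fun i => ?_⟩
  have hex : ∀ s : level (compressionTest C D) i, ∃ q, (s : List Bool) ∈ C q ∧
      (q.length + i : ℝ) < D * (s : List Bool).length := fun s => s.2
  choose q hq hlt using hex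
  -- A program has only one output, so the choice of programs is injective and Kraft's inequality on
  -- the domain applies.
  let φ : level (compressionTest C D) i → C.Dom := fun s => ⟨q s, Part.dom_iff_mem.2 ⟨_, hq s⟩⟩
  have hφ : Function.Injective φ := fun s t hst => by
    have : q s = q t := congrArg Subtype.val hst
    exact Subtype.ext (Part.mem_unique (hq s) (this ▸ hq t))
  calc ∑' s : level (compressionTest C D) i, (2 : ℝ≥0∞) ^ (-(D * (s : List Bool).length))
      ≤ ∑' s, (2 : ℝ≥0∞) ^ (-((φ s : List Bool).length : ℝ)) * 2 ^ (-(i : ℝ)) := by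
        refine ENNReal.tsum_le_tsum fun s => ?_
        rw [← ENNReal.rpow_add _ _ (by simp) (by simp)]
        exact ENNReal.rpow_le_rpow_of_exponent_le (by simp)
          (by have := hlt s; simp only [φ]; linarith)
    _ = (∑' s, (2 : ℝ≥0∞) ^ (-((φ s : List Bool).length : ℝ))) * 2 ^ (-(i : ℝ)) :=
        ENNReal.tsum_mul_right
    _ ≤ 1 * 2 ^ (-(i : ℝ)) := by
        gcongr
        exact (ENNReal.tsum_comp_le_tsum_of_injective hφ
          (fun p : C.Dom => (2 : ℝ≥0∞) ^ (-((p : List Bool).length : ℝ)))).trans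
          hC.prefixFree.tsum_le_one
    _ = _ := one_mul _

theorem IsMartinLofRandom.isWeaklyChaitinRandom {U : List Bool →. List Bool} (hU : IsComputer U)
    {D : ℝ} (hD : IsComputableReal D) (hD0 : 0 ≤ D) {α : ℕ → Bool}
    (hα : IsMartinLofRandom D α) : IsWeaklyChaitinRandom U D α := by
  obtain ⟨i, hi⟩ := hα _ (isMartinLofTest_compressionTest hU hD hD0)
  refine isWeaklyChaitinRandom_iff.2 ⟨i, fun n p hp => ?_⟩
  by_contra hlt
  refine hi ⟨n, p, hp, ?_⟩
  rw [length_initialSegment]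
  push Not at hlt
  linarith

/-! ### From a Martin-Löf test to a compressing computer. -/

/-- A single term cannot exceed the bound on the whole sum. This keeps the requested lengths L - i
free of truncation. -/
theorem IsMartinLofTest.le_of_mem {D : ℝ} {T : Set (ℕ × List Bool)} (hT : IsMartinLofTest D T)
    {i : ℕ} {s : List Bool} (hs : (i, s) ∈ T) : (i : ℝ) ≤ D * s.length := by
  have h := (ENNReal.le_tsum (f := fun s : level T i =>
    (2 : ℝ≥0∞) ^ (-(D * (s : List Bool).length))) ⟨s, hs⟩).trans (hT.sum_le i)
  by_contra! hlt
  exact absurd h (not_le.2 (ENNReal.rpow_lt_rpow_of_exponent_lt (by simp) (by simp)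
    (neg_lt_neg hlt)))

theorem tsum_two_rpow_neg_succ : ∑' i : ℕ, (2 : ℝ≥0∞) ^ (-((i : ℝ) + 1)) = 1 := by
  have h : ∀ i : ℕ, (2 : ℝ≥0∞) ^ (-((i : ℝ) + 1)) = 2⁻¹ ^ (i + 1) := fun i => by
    rw [ENNReal.rpow_neg, ← ENNReal.inv_pow, ← ENNReal.rpow_natCast]
    push_cast
    rfl
  simp_rw [h]
  rw [ENNReal.tsum_geometric_add_one, ENNReal.one_sub_inv_two, inv_inv,
    ENNReal.inv_mul_cancel (by simp) (by simp)]

/-- A Martin-Löf `D`-test compresses the sequences of its level `2 i + 1` by `i` bits. -/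
theorem IsMartinLofTest.exists_computer {D : ℝ} (hD : IsComputableReal D) (hD0 : 0 ≤ D)
    {T : Set (ℕ × List Bool)} (hT : IsMartinLofTest D T) :
    ∃ C, IsComputer C ∧ ∀ (i : ℕ) (s : List Bool), (2 * i + 1, s) ∈ T →
      ∃ p, s ∈ C p ∧ (p.length : ℝ) ≤ D * s.length - i + 3 := by
  obtain ⟨A, hA, hAD⟩ := hD.exists_approx hD0
  obtain ⟨h, hh, hTh, huniq⟩ := exists_enumeration hT.re
  -- A computable integer substitute for Dn. The approximation loses at most n / 2^n < 1 and the
  -- floor less than 1, so adding 2 gives Dn ≤ L n ≤ Dn + 2.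
  let L : ℕ → ℕ := fun n => A n * n / 2 ^ n + 2
  have hL : Computable L :=
    Computable.succ.comp (Computable.succ.comp (Primrec.nat_div.to_comp.comp
      (Primrec.nat_mul.to_comp.comp hA Computable.id) primrec_two_pow.to_comp))
  have hLlow : ∀ n, D * n ≤ L n := by
    intro n
    have h1 : A n * n < 2 ^ n * (A n * n / 2 ^ n + 1) := Nat.lt_mul_div_succ _ (by positivity)
    have h2 : (A n * n : ℝ) < 2 ^ n * ((A n * n / 2 ^ n : ℕ) + 1) := by exact_mod_cast h1
    have h3 : D * 2 ^ n * n ≤ (A n + 1) * n := by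
      gcongr
      exact (hAD n).2
    have h4 : (n : ℝ) < 2 ^ n := by exact_mod_cast Nat.lt_two_pow_self
    have h5 : D * n * 2 ^ n ≤ (L n : ℝ) * 2 ^ n := by
      simp only [L]
      push_cast at h2 ⊢
      linarith
    exact le_of_mul_le_mul_right h5 (by positivity)
  have hLup : ∀ n, (L n : ℝ) ≤ D * n + 2 := by
    intro n
    have h1 : A n * n / 2 ^ n * 2 ^ n ≤ A n * n := Nat.div_mul_le_self _ _
    have h2 : ((A n * n / 2 ^ n : ℕ) : ℝ) * 2 ^ n ≤ A n * n := by exact_mod_cast h1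
    have h3 : (A n : ℝ) * n ≤ D * 2 ^ n * n := by
      gcongr
      exact (hAD n).1
    have h5 : ((A n * n / 2 ^ n : ℕ) : ℝ) * 2 ^ n ≤ D * n * 2 ^ n := by linarith
    have h6 := le_of_mul_le_mul_right h5 (by positivity)
    simp only [L]
    push_cast at h6 ⊢
    linarith
  -- The index j codes ((i, s), k), where k is the stage at which s enters level 2i+1. Requiring j
  -- to be the canonical code prevents duplicate requests.
  let req : ℕ → Option (List Bool × ℕ) := fun j =>
    (Encodable.decode j : Option ((ℕ × List Bool) × ℕ)).bind fun z =>
      cond (h (2 * z.1.1 + 1, z.1.2) z.2 && decide (Encodable.encode z = j))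
        (some (z.1.2, L z.1.2.length - z.1.1)) none
  have hreq : Computable req := by
    refine Computable.decode.option_bind (show Computable _ from ?_)
    have hi : Primrec fun z : ℕ × (ℕ × List Bool) × ℕ => z.2.1.1 :=
      Primrec.fst.comp (Primrec.fst.comp Primrec.snd)
    have hs : Primrec fun z : ℕ × (ℕ × List Bool) × ℕ => z.2.1.2 :=
      Primrec.snd.comp (Primrec.fst.comp Primrec.snd)
    refine Computable.cond (Primrec.and.to_comp.comp (hh.comp
      ((Primrec.nat_double_succ.comp hi).to_comp.pair hs.to_comp)
      (Computable.snd.comp Computable.snd)) (Primrec.eq.decide.comp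
        (Primrec.encode.comp Primrec.snd) Primrec.fst).to_comp)
      (Computable.option_some.comp (hs.to_comp.pair ?_)) (Computable.const none)
    exact Primrec.nat_sub.to_comp.comp
      (hL.comp (Primrec.list_length.comp hs).to_comp) hi.to_comp
  have hmemT : ∀ {i s k}, h (2 * i + 1, s) k = true → (2 * i + 1, s) ∈ T := fun hk =>
    (hTh _).2 ⟨_, hk⟩
  have hsub : ∀ {i s}, (2 * i + 1, s) ∈ T →
      ((L s.length - i : ℕ) : ℝ) = L s.length - i := by
    intro i s hs
    have h1 := hT.le_of_mem hs
    have h2 := hLlow s.length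
    push_cast at h1
    refine Nat.cast_sub ?_
    have : (i : ℝ) ≤ L s.length := by
      have : (0 : ℝ) ≤ i := by positivity
      linarith
    exact_mod_cast this
  have hreq_some : ∀ {j s l}, req j = some (s, l) → ∃ i k, h (2 * i + 1, s) k = true ∧
      l = L s.length - i ∧ j = Encodable.encode ((i, s), k) := by
    intro j s l hj
    obtain ⟨⟨⟨i, s'⟩, k⟩, -, hj⟩ := Option.bind_eq_some_iff.1 hj
    dsimp only at hj
    cases hc : h (2 * i + 1, s') k && decide (Encodable.encode ((i, s'), k) = j) <;> rw [hc] at hj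
    · simp at hj
    · simp only [cond_true, Option.some_inj, Prod.mk.injEq] at hj
      obtain ⟨rfl, rfl⟩ := hj
      rw [Bool.and_eq_true, decide_eq_true_eq] at hc
      exact ⟨i, k, hc.1, rfl, hc.2.symm⟩
  have htotal : ∑' j, ENNReal.ofReal (requestWeight (req j)) ≤ 1 := by
    let S : Set ℕ := {j | (req j).isSome = true}
    have hS : ∀ j : S, ∃ i s k, req j = some (s, L s.length - i) ∧
        h (2 * i + 1, s) k = true ∧ (j : ℕ) = Encodable.encode ((i, s), k) := by
      rintro ⟨j, hj⟩
      obtain ⟨⟨s, l⟩, hsl⟩ := Option.isSome_iff_exists.1 hj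
      obtain ⟨i, k, hk, rfl, hd⟩ := hreq_some hsl
      exact ⟨i, s, k, hsl, hk, hd⟩
    choose ι σ κ hrq hκ hdec using hS
    -- A string may be requested once for each i, hence the disjoint union of levels. Injectivity
    -- rests on the uniqueness of the stage and of the code.
    let φ : S → Σ i, level T (2 * i + 1) := fun j => ⟨ι j, σ j, hmemT (hκ j)⟩
    have hφ : Function.Injective φ := by
      intro j j' hjj
      have h1 : ι j = ι j' := congrArg Sigma.fst hjj
      have h2 : σ j = σ j' :=
        congrArg (fun z : Σ i, level T (2 * i + 1) => (z.2 : List Bool)) hjj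
      have h3 : κ j = κ j' := huniq _ _ _ (hκ j) (by rw [h1, h2]; exact hκ j')
      exact Subtype.ext (by rw [hdec, hdec, h1, h2, h3])
    let w : (Σ i, level T (2 * i + 1)) → ℝ≥0∞ := fun z =>
      2 ^ (z.1 : ℝ) * 2 ^ (-(D * (z.2 : List Bool).length))
    calc ∑' j, ENNReal.ofReal (requestWeight (req j))
        = ∑' j : S, ENNReal.ofReal (requestWeight (req j)) := by
          refine (tsum_subtype_eq_of_support_subset fun j hj => ?_).symm
          by_contra hn
          have : req j = none := by simpa [S] using hn
          simp [this, requestWeight] at hj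
      _ ≤ ∑' j : S, w (φ j) := by
          refine ENNReal.tsum_le_tsum fun j => ?_
          rw [hrq j]
          simp only [requestWeight, Option.elim_some, w, φ]
          rw [ofReal_half_pow, hsub (hmemT (hκ j)), ← ENNReal.rpow_add _ _ (by simp) (by simp)]
          refine ENNReal.rpow_le_rpow_of_exponent_le (by simp) ?_
          have := hLlow (σ j).length
          linarith
      _ ≤ ∑' z, w z := ENNReal.tsum_comp_le_tsum_of_injective hφ w
      _ = ∑' i : ℕ, ∑' s : level T (2 * i + 1),
            (2 : ℝ≥0∞) ^ (i : ℝ) * 2 ^ (-(D * (s : List Bool).length)) := ENNReal.tsum_sigma' w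
      _ ≤ ∑' i : ℕ, (2 : ℝ≥0∞) ^ (-((i : ℝ) + 1)) := by
          refine ENNReal.tsum_le_tsum fun i => ?_
          rw [ENNReal.tsum_mul_left]
          refine (mul_le_mul_right (hT.sum_le (2 * i + 1)) _).trans (le_of_eq ?_)
          rw [← ENNReal.rpow_add _ _ (by simp) (by simp)]
          congr 1
          push_cast
          ring
      _ = 1 := tsum_two_rpow_neg_succ
  obtain ⟨C, hC, hCreq⟩ := exists_computer_of_requests hreq fun n => by
    have h1 := (ENNReal.sum_le_tsum (Finset.range n)).trans htotal
    rw [← ENNReal.ofReal_sum_of_nonneg fun _ _ => requestWeight_nonneg _] at h1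
    exact ENNReal.ofReal_le_one.1 h1
  refine ⟨C, hC, fun i s hs => ?_⟩
  obtain ⟨k, hk⟩ := (hTh _).1 hs
  obtain ⟨p, hp, hlen⟩ := hCreq (Encodable.encode ((i, s), k)) s (L s.length - i) (by
    simp [req, hk])
  refine ⟨p, hp, ?_⟩
  rw [hlen]
  push_cast
  rw [hsub hs]
  -- The constant 3 is the 2 lost in `L` plus the extra bit of the codeword.
  have := hLup s.length
  linarith

/-! ### From incompressibility to Martin-Löf randomness. -/

theorem IsWeaklyChaitinRandom.isMartinLofRandom {U : List Bool →. List Bool}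
    (hU : IsUniversalComputer U) {D : ℝ} (hD : IsComputableReal D) (hD0 : 0 ≤ D) {α : ℕ → Bool}
    (hα : IsWeaklyChaitinRandom U D α) : IsMartinLofRandom D α := by
  obtain ⟨c, hc⟩ := isWeaklyChaitinRandom_iff.1 hα
  intro T hT
  obtain ⟨C, hC, hCT⟩ := hT.exists_computer hD hD0
  obtain ⟨sim, hsim⟩ := hU.simulates C hC
  -- A saving of i bits must outweigh the randomness deficiency c, the simulation overhead and the
  -- constant 3.
  obtain ⟨i, hi⟩ := exists_nat_gt (c + sim + 3)
  refine ⟨2 * i + 1, ?_⟩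
  rintro ⟨n, hn⟩
  obtain ⟨p, hp, hplen⟩ := hCT i _ hn
  obtain ⟨q, hq, hqlen⟩ := hsim p _ hp
  have h1 := hc n q hq
  have h2 : (q.length : ℝ) ≤ p.length + sim := by exact_mod_cast hqlen
  rw [length_initialSegment] at hplen
  linarith

end DRandomness

theorem mainTheorem4 (U : List Bool →. List Bool) (hU : DRandomness.IsUniversalComputer U)
    (D : ℝ) (hD : DRandomness.IsComputableReal D) (hD0 : 0 ≤ D) (α : ℕ → Bool) :
    DRandomness.IsWeaklyChaitinRandom U D α ↔ DRandomness.IsMartinLofRandom D α :=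
  ⟨fun h => h.isMartinLofRandom hU hD hD0,
    fun h => h.isWeaklyChaitinRandom hU.isComputer hD hD0⟩
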